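/- For integers $t\ge 2$ and $n\ge 1$, a family $\mathcal F$ of subsets of an $n$-element set is called $t$-cancellative if for all $t+2$ distinct members $A_1,\dots,A_t,B,C$ of $\mathcal F$ one has $$A_1\cup\dots\cup A_t\cup B\neq A_1\cup\dots\cup A_t\cup C .$$ Let $c(n,t)$ denote the maximum size of a $t$-cancellative family of subsets of an $n$-element set, and let $\log$ denote the logarithm to base $2$. **Theorem.** There exist positive absolute constants $\beta_1,\beta_2$ and, for every integer $t\ge 2$, a bound $n_0(t)$ depending only on $t$, such that for all integers $t\ge 2$ and $n>n_0(t)$, $$\beta_1\,\frac{1}{t^2}<\frac{\log c(n,t)}{n}<\beta_2\,\frac{\log t}{t^2}.$$ -/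

import Mathlib

/-- A family `F` of finite sets is `t`-cancellative if for all distinct `t + 2` members
`A₁, …, A_t` and `B, C` of `F` one has `A₁ ∪ ⋯ ∪ A_t ∪ B ≠ A₁ ∪ ⋯ ∪ A_t ∪ C`.
The `t` distinct members `A₁, …, A_t` are given as the set `𝒜` of size `t`. -/
def IsTCancellative {α : Type*} [DecidableEq α] (t : ℕ) (F : Finset (Finset α)) : Prop :=
  ∀ 𝒜 : Finset (Finset α), 𝒜 ⊆ F → 𝒜.card = t →
    ∀ B ∈ F, ∀ C ∈ F, B ∉ 𝒜 → C ∉ 𝒜 → B ≠ C → 𝒜.biUnion id ∪ B ≠ 𝒜.biUnion id ∪ C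

/-- `c(n,t)`: the maximum size of a `t`-cancellative family of subsets of an `n`-element set. -/
noncomputable def maxTCancellative (n t : ℕ) : ℕ :=
  sSup {m : ℕ | ∃ F : Finset (Finset (Fin n)), IsTCancellative t F ∧ F.card = m}

/-- The supremum defining `c(n,t)` is attained, so it is a maximum. -/
theorem maxTCancellative_isGreatest (n t : ℕ) :
    IsGreatest {m : ℕ | ∃ F : Finset (Finset (Fin n)), IsTCancellative t F ∧ F.card = m}
      (maxTCancellative n t) := by
  have hb : BddAbove
      {m : ℕ | ∃ F : Finset (Finset (Fin n)), IsTCancellative t F ∧ F.card = m} := by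
    refine ⟨Fintype.card (Finset (Fin n)), ?_⟩
    rintro m ⟨F, -, rfl⟩
    exact Finset.card_le_univ F
  refine ⟨Nat.sSup_mem ⟨0, ∅, ?_, rfl⟩ hb, fun m hm => le_csSup hb hm⟩
  intro 𝒜 _ _ B hB
  simp at hB

/-!
Both bounds compare `t`-cancellative families with cover-free families, in which no member is
contained in the union of at most `s` others.

*Upper bound.* Let `s = ⌊t / 2⌋`. If a member `B` is covered by at most `s` others and, after
deleting all of these sets, another member `C` is again covered by at most `s` remaining ones, then
the two covers, padded to `t` sets, violate cancellativity for `B` and `C`. So deleting at most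
`s + 1` members leaves an `s`-cover-free family (`IsTCancellative.exists_isCoverFree`). In such a
family on `n` points call a subset of size at most `τ` of a member *own* if it is contained in no
other member. A member `B` without an own subset can have any `τ` of its points covered by one other
member, so more than `τ * (s - i)` of its points remain uncovered by any `i` others
(`IsCoverFree.lt_card_sdiff`). Hence `s + 1` such members would have a union of size at least
`τ * s * (s + 1) / 2`, which exceeds `n` for `τ ≈ 2 * n / s ^ 2`. All but `s` members therefore have
an own subset, and the number of these is at most the number of sets of size at most `τ`, which is
at most `D ^ τ * exp (n / D)` for every `D ≥ 1`; the choice `D = s ^ 2` gives the exponent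
`O(log t / t ^ 2)` (`IsCoverFree.card_le`).

*Lower bound.* A `(t + 1)`-cover-free family is `t`-cancellative. A greedily chosen code of length
`a * (t + 1)` over an alphabet of size `6 * (t + 1)`, in which distinct words agree in fewer than
`a` positions, has at least `2 ^ a` words. The graphs of its words are sets of size `a * (t + 1)`
with pairwise intersections smaller than `a`, so they form a `(t + 1)`-cover-free family on
`6 * a * (t + 1) ^ 2` points (`two_pow_le_maxTCancellative`).
-/

/-- A family is `s`-cover-free if no member is contained in the union of at most `s` others. -/
def IsCoverFree {α : Type*} [DecidableEq α] (s : ℕ) (F : Finset (Finset α)) : Prop :=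
  ∀ B ∈ F, ∀ 𝒜 : Finset (Finset α), 𝒜 ⊆ F → B ∉ 𝒜 → 𝒜.card ≤ s → ¬ B ⊆ 𝒜.biUnion id

/-- `B` has an own subset of size at most `τ` in `F`: a subset of `B` with at most `τ` elements
that is contained in no other member of `F`. -/
def HasOwnSubset {α : Type*} (τ : ℕ) (F : Finset (Finset α)) (B : Finset α) : Prop :=
  ∃ T : Finset α, T ⊆ B ∧ T.card ≤ τ ∧ ∀ B' ∈ F, T ⊆ B' → B' = B

/-! ### The number of small sets -/

theorem card_filter_card_le_le {α : Type*} [Fintype α] {D : ℕ} (hD : 1 ≤ D) (τ : ℕ) :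
    (((Finset.univ : Finset (Finset α)).filter fun T => T.card ≤ τ).card : ℝ) ≤
      (D : ℝ) ^ τ * Real.exp (Fintype.card α / D) := by
  have hD' : (1 : ℝ) ≤ D := by exact_mod_cast hD
  have hD0 : (0 : ℝ) < D := by linarith
  -- Weight each set `T` by `D⁻¹ ^ #T`; small sets have weight at least `D⁻¹ ^ τ`.
  have h1 : (((Finset.univ : Finset (Finset α)).filter fun T => T.card ≤ τ).card : ℝ) *
      (D : ℝ)⁻¹ ^ τ ≤ ∑ T : Finset α, (D : ℝ)⁻¹ ^ T.card := by
    rw [← nsmul_eq_mul]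
    refine (Finset.card_nsmul_le_sum _ (fun T => (D : ℝ)⁻¹ ^ T.card) _ ?_).trans
      (Finset.sum_le_sum_of_subset_of_nonneg (Finset.filter_subset _ _) ?_)
    · intro T hT
      exact pow_le_pow_of_le_one (by positivity) (inv_le_one_of_one_le₀ hD')
        (Finset.mem_filter.1 hT).2
    · intros
      positivity
  have h2 : ∑ T : Finset α, (D : ℝ)⁻¹ ^ T.card = ((D : ℝ)⁻¹ + 1) ^ Fintype.card α := by
    simpa using Fintype.sum_pow_mul_eq_add_pow α (D : ℝ)⁻¹ 1
  have h3 : ((D : ℝ)⁻¹ + 1) ^ Fintype.card α ≤ Real.exp (Fintype.card α / D) := by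
    rw [div_eq_mul_inv, Real.exp_nat_mul]
    exact pow_le_pow_left₀ (by positivity) (Real.add_one_le_exp _) _
  rw [h2, inv_pow, ← div_eq_mul_inv, div_le_iff₀ (by positivity)] at h1
  rw [mul_comm]
  exact h1.trans (mul_le_mul_of_nonneg_right h3 (by positivity))

/-! ### Cancellative and cover-free families -/

section Families

variable {α : Type*} [DecidableEq α] {F : Finset (Finset α)} {s t : ℕ}

theorem IsCoverFree.isTCancellative (h : IsCoverFree (t + 1) F) : IsTCancellative t F := by
  intro 𝒜 h𝒜 hcard B hB C hC hB𝒜 hC𝒜 hBC heq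
  refine h B hB (insert C 𝒜) (Finset.insert_subset hC h𝒜) (by simp [hBC, hB𝒜]) ?_ ?_
  · exact (Finset.card_insert_le _ _).trans (by omega)
  · rw [Finset.biUnion_insert, id, Finset.union_comm, ← heq]
    exact Finset.subset_union_right

/-- Deleting at most `s + 1` members makes a `t`-cancellative family `s`-cover-free when
`2 * s ≤ t`: two disjoint violations of cover-freeness would give two members `B`, `C` both
contained in the union of the same `t` others. -/
theorem IsTCancellative.exists_isCoverFree (h : IsTCancellative t F) (hs : 2 * s ≤ t)
    (hF : t + 2 ≤ F.card) :
    ∃ G ⊆ F, IsCoverFree s G ∧ F.card ≤ G.card + (s + 1) := by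
  by_cases hcf : IsCoverFree s F
  · exact ⟨F, subset_rfl, hcf, by omega⟩
  unfold IsCoverFree at hcf
  push Not at hcf
  obtain ⟨B, hB, 𝒜, h𝒜, hB𝒜, hcard, hsub⟩ := hcf
  refine ⟨F \ insert B 𝒜, Finset.sdiff_subset, ?_, ?_⟩
  · intro C hC 𝒜' h𝒜' hC𝒜' hcard' hsub'
    simp only [Finset.mem_sdiff, Finset.mem_insert, not_or] at hC
    have hB𝒜' : B ∉ 𝒜' := fun hh => by simpa using h𝒜' hh
    have h𝒜'F : 𝒜' ⊆ F := h𝒜'.trans Finset.sdiff_subset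
    -- Pad the two covers with further members to reach exactly `t` sets.
    obtain ⟨𝒟, h1, h2, h3⟩ := Finset.exists_subsuperset_card_eq
      (s := 𝒜 ∪ 𝒜') (t := (F.erase B).erase C) (n := t)
      (by
        intro X hX
        simp only [Finset.mem_erase]
        rcases Finset.mem_union.1 hX with hX | hX
        · exact ⟨fun e => hC.2.2 (e ▸ hX), fun e => hB𝒜 (e ▸ hX), h𝒜 hX⟩
        · exact ⟨fun e => hC𝒜' (e ▸ hX), fun e => hB𝒜' (e ▸ hX), h𝒜'F hX⟩)
      ((Finset.card_union_le _ _).trans (by omega))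
      (by
        rw [Finset.card_erase_of_mem (by simp [hC.1, hC.2.1]), Finset.card_erase_of_mem hB]
        omega)
    refine h 𝒟 (fun X hX => ?_) h3 B hB C hC.1 (fun hX => ?_) (fun hX => ?_) (Ne.symm hC.2.1) ?_
    · have := h2 hX
      simp only [Finset.mem_erase] at this
      exact this.2.2
    · have := h2 hX
      simp at this
    · have := h2 hX
      simp at this
    · have hBD : B ⊆ 𝒟.biUnion id := hsub.trans
        (Finset.biUnion_subset_biUnion_of_subset_left _ (Finset.subset_union_left.trans h1))
      have hCD : C ⊆ 𝒟.biUnion id := hsub'.trans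
        (Finset.biUnion_subset_biUnion_of_subset_left _ (Finset.subset_union_right.trans h1))
      rw [Finset.union_eq_left.2 hBD, Finset.union_eq_left.2 hCD]
  · have h1 := Finset.le_card_sdiff (insert B 𝒜) F
    have h2 := Finset.card_insert_le B 𝒜
    omega

/-- Families of large sets with small pairwise intersections are cover-free. -/
theorem isCoverFree_of_card_inter_le {k m : ℕ} (hk : ∀ B ∈ F, B.card = k)
    (hm : ∀ B ∈ F, ∀ A ∈ F, A ≠ B → (B ∩ A).card ≤ m) (hs : s * m < k) : IsCoverFree s F := by
  intro B hB 𝒜 h𝒜 hB𝒜 hcard hsub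
  have h1 : B = 𝒜.biUnion fun A => B ∩ A := by
    rw [← Finset.inter_biUnion]
    exact (Finset.inter_eq_left.2 hsub).symm
  have h2 : B.card ≤ 𝒜.card * m := by
    conv_lhs => rw [h1]
    exact Finset.card_biUnion_le_card_mul _ _ _ fun A hA =>
      hm B hB A (h𝒜 hA) fun e => hB𝒜 (e ▸ hA)
  have := Nat.mul_le_mul_right m hcard
  have := hk B hB
  omega

/-! ### Upper bound: own subsets -/

/-- If `B` has no small own subset, then covering `B \ ⋃ 𝒜` greedily by members of `F`, `τ` elements
at a time, would cover `B` by too few sets unless `B \ ⋃ 𝒜` is large. -/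
theorem IsCoverFree.lt_card_sdiff (h : IsCoverFree s F) {τ : ℕ} {B : Finset α} (hB : B ∈ F)
    (hown : ¬ HasOwnSubset τ F B) (i : ℕ) :
    ∀ 𝒜 : Finset (Finset α), 𝒜 ⊆ F → B ∉ 𝒜 → 𝒜.card + i ≤ s →
      τ * i < (B \ 𝒜.biUnion id).card := by
  induction i with
  | zero =>
    intro 𝒜 h𝒜 hB𝒜 hc
    rw [mul_zero, Finset.card_pos, Finset.sdiff_nonempty]
    exact h B hB 𝒜 h𝒜 hB𝒜 (by omega)
  | succ i ih =>
    intro 𝒜 h𝒜 hB𝒜 hc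
    obtain ⟨T, hT, hTc⟩ := Finset.exists_subset_card_eq
      (min_le_right τ (B \ 𝒜.biUnion id).card)
    have : ∃ B' ∈ F, T ⊆ B' ∧ B' ≠ B := by
      by_contra! hcon
      exact hown ⟨T, hT.trans Finset.sdiff_subset, by omega, hcon⟩
    obtain ⟨B', hB', hTB', hne⟩ := this
    have h1 := ih (insert B' 𝒜) (Finset.insert_subset hB' h𝒜) (by simp [hne.symm, hB𝒜])
      (by have := Finset.card_insert_le B' 𝒜; omega)
    have h2 : B \ (insert B' 𝒜).biUnion id ⊆ (B \ 𝒜.biUnion id) \ T := by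
      rw [Finset.biUnion_insert, id]
      intro x hx
      simp only [Finset.mem_sdiff, Finset.mem_union, not_or] at hx ⊢
      exact ⟨⟨hx.1, hx.2.2⟩, fun hxT => hx.2.1 (hTB' hxT)⟩
    have h3 := Finset.card_le_card h2
    rw [Finset.card_sdiff_of_subset hT] at h3
    rw [mul_add, mul_one]
    omega

/-- Adding the sets of `G` to their union one by one, the set added after `i` others contributes at
least `τ * (s - i)` new elements. -/
theorem IsCoverFree.sum_le_card_biUnion (h : IsCoverFree s F) {τ : ℕ} (G : Finset (Finset α)) :
    G ⊆ F → (∀ B ∈ G, ¬ HasOwnSubset τ F B) → G.card ≤ s + 1 →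
      ∑ i ∈ Finset.range G.card, τ * (s - i) ≤ (G.biUnion id).card := by
  induction G using Finset.induction_on with
  | empty => simp
  | insert B G hBG ih =>
    intro hG hown hc
    rw [Finset.card_insert_of_notMem hBG] at hc ⊢
    have h1 := ih (fun X hX => hG (Finset.mem_insert_of_mem hX))
      (fun X hX => hown X (Finset.mem_insert_of_mem hX)) (by omega)
    have h2 := h.lt_card_sdiff (hG (Finset.mem_insert_self B G))
      (hown B (Finset.mem_insert_self B G)) (s - G.card) G
      (fun X hX => hG (Finset.mem_insert_of_mem hX)) hBG (by omega)
    rw [Finset.sum_range_succ, Finset.biUnion_insert, id,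
      ← Finset.card_sdiff_add_card B (G.biUnion id)]
    omega

/-- There are at most `s` members without a small own subset: the union of `s + 1` of them would
have at least `τ * (s + (s - 1) + ⋯ + 1)` elements, more than the ground set. -/
theorem IsCoverFree.card_le_of_not_hasOwnSubset [Fintype α] (h : IsCoverFree s F) {τ : ℕ}
    (hτ : 2 * Fintype.card α < τ * (s * (s + 1))) (G : Finset (Finset α)) (hG : G ⊆ F)
    (hown : ∀ B ∈ G, ¬ HasOwnSubset τ F B) : G.card ≤ s := by
  by_contra! hlt
  obtain ⟨G', hG', hc⟩ := Finset.exists_subset_card_eq (Nat.succ_le_of_lt hlt)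
  have h1 := h.sum_le_card_biUnion G' (hG'.trans hG) (fun B hB => hown B (hG' hB)) hc.le
  rw [hc, ← Finset.mul_sum] at h1
  have h2 : ∑ i ∈ Finset.range (s + 1), (s - i) = ∑ i ∈ Finset.range (s + 1), i :=
    Finset.sum_range_reflect (fun i => i) (s + 1)
  have h3 := Finset.sum_range_id_mul_two (s + 1)
  have h4 := Finset.card_le_univ (G'.biUnion id)
  rw [Nat.succ_eq_add_one, h2] at h1
  have h5 : τ * (s * (s + 1)) = τ * (∑ i ∈ Finset.range (s + 1), i) * 2 := by
    rw [mul_assoc, h3, Nat.add_sub_cancel, mul_comm s]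
  omega

/-- Besides the at most `s` members without a small own subset, a cover-free family has no more
members than there are small sets, because an own subset determines its member. -/
theorem IsCoverFree.card_le [Fintype α] (h : IsCoverFree s F) {τ D : ℕ} (hD : 1 ≤ D)
    (hτ : 2 * Fintype.card α < τ * (s * (s + 1))) :
    (F.card : ℝ) ≤ s + (D : ℝ) ^ τ * Real.exp (Fintype.card α / D) := by
  classical
  have h1 := h.card_le_of_not_hasOwnSubset hτ (F.filter fun B => ¬ HasOwnSubset τ F B)
    (Finset.filter_subset _ _) (fun B hB => (Finset.mem_filter.1 hB).2)
  have h2 : (F.filter fun B => HasOwnSubset τ F B).card ≤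
      ((Finset.univ : Finset (Finset α)).filter fun T => T.card ≤ τ).card := by
    have hex : ∀ B ∈ F.filter (fun B => HasOwnSubset τ F B), HasOwnSubset τ F B :=
      fun B hB => (Finset.mem_filter.1 hB).2
    choose! T hT using hex
    refine Finset.card_le_card_of_injOn T (fun B hB => ?_) (fun B hB C hC heq => ?_)
    · simpa using (hT B hB).2.1
    · refine (hT C hC).2.2 B (Finset.mem_filter.1 hB).1 ?_
      rw [← heq]
      exact (hT B hB).1
  have h3 := card_filter_card_le_le (α := α) hD τ
  have h4 := Finset.card_filter_add_card_filter_not (s := F) (fun B => HasOwnSubset τ F B)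
  have h5 : (F.card : ℝ) ≤ s +
      ((Finset.univ : Finset (Finset α)).filter fun T => T.card ≤ τ).card := by
    exact_mod_cast (by omega)
  linarith

end Families

/-! ### Lower bound: a greedy code -/

section Code

variable {ι κ : Type*} [Fintype ι] [DecidableEq ι] [Fintype κ] [DecidableEq κ]

theorem card_filter_le_card_agree_le (f : ι → κ) (a : ℕ) :
    ((Finset.univ : Finset (ι → κ)).filter fun g =>
        a ≤ (Finset.univ.filter fun i => f i = g i).card).card ≤
      (Fintype.card ι).choose a * Fintype.card κ ^ (Fintype.card ι - a) := by
  have hsub : ((Finset.univ : Finset (ι → κ)).filter fun g =>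
        a ≤ (Finset.univ.filter fun i => f i = g i).card) ⊆
      (Finset.powersetCard a Finset.univ).biUnion fun S =>
        Fintype.piFinset fun i => if i ∈ S then {f i} else Finset.univ := by
    intro g hg
    obtain ⟨S, hS, hSc⟩ := Finset.exists_subset_card_eq (Finset.mem_filter.1 hg).2
    rw [Finset.mem_biUnion]
    refine ⟨S, by simp [hSc], ?_⟩
    rw [Fintype.mem_piFinset]
    intro i
    split_ifs with hi
    · have := hS hi
      simp only [Finset.mem_filter, Finset.mem_univ, true_and] at this
      simp [this]
    · simp
  refine (Finset.card_le_card hsub).trans ?_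
  have := Finset.card_biUnion_le_card_mul (Finset.powersetCard a (Finset.univ : Finset ι))
    (fun S => Fintype.piFinset fun i => if i ∈ S then {f i} else (Finset.univ : Finset κ))
    (Fintype.card κ ^ (Fintype.card ι - a)) ?_
  · simpa using this
  · intro S hS
    rw [Finset.mem_powersetCard] at hS
    rw [Fintype.card_piFinset]
    refine le_of_eq ?_
    calc ∏ i, (if i ∈ S then {f i} else (Finset.univ : Finset κ)).card
        = ∏ i, if i ∈ S then 1 else Fintype.card κ :=
          Finset.prod_congr rfl fun i _ => by split_ifs <;> simp
      _ = Fintype.card κ ^ (Fintype.card ι - a) := by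
          rw [Finset.prod_ite, Finset.prod_const_one, one_mul, Finset.prod_const]
          congr 1
          rw [← hS.2, ← Finset.card_compl]
          congr 1
          ext i
          simp

/-- The Gilbert–Varshamov bound: the balls around the words of a maximal code cover all words. -/
theorem exists_code {a : ℕ} (ha : a ≤ Fintype.card ι) :
    ∃ C : Finset (ι → κ),
      (∀ f ∈ C, ∀ g ∈ C, f ≠ g → (Finset.univ.filter fun i => f i = g i).card < a) ∧
      Fintype.card κ ^ Fintype.card ι ≤
        C.card * ((Fintype.card ι).choose a * Fintype.card κ ^ (Fintype.card ι - a)) := by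
  classical
  let P : Finset (ι → κ) → Prop := fun C =>
    ∀ f ∈ C, ∀ g ∈ C, f ≠ g → (Finset.univ.filter fun i => f i = g i).card < a
  obtain ⟨C, hC, hmax⟩ := Finset.exists_max_image
    ((Finset.univ : Finset (Finset (ι → κ))).filter P) Finset.card ⟨∅, by simp [P]⟩
  have hCP : P C := (Finset.mem_filter.1 hC).2
  refine ⟨C, hCP, ?_⟩
  have hcover : (Finset.univ : Finset (ι → κ)) ⊆ C.biUnion fun f =>
      Finset.univ.filter fun g => a ≤ (Finset.univ.filter fun i => f i = g i).card := by
    intro g _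
    by_contra hg
    simp only [Finset.mem_biUnion, Finset.mem_filter, Finset.mem_univ, true_and, not_exists,
      not_and, not_le] at hg
    have hgC : g ∉ C := fun h => by
      have := hg g h
      simp only [Finset.filter_true, Finset.card_univ] at this
      omega
    have hP : P (insert g C) := by
      intro f hf f' hf' hne
      rcases Finset.mem_insert.1 hf with hfg | hfC <;>
        rcases Finset.mem_insert.1 hf' with hfg' | hfC'
      · exact absurd (hfg.trans hfg'.symm) hne
      · subst hfg
        simpa only [eq_comm] using hg f' hfC'
      · subst hfg'
        exact hg f hfC
      · exact hCP f hfC f' hfC' hne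
    have := hmax (insert g C) (by simp [hP])
    rw [Finset.card_insert_of_notMem hgC] at this
    omega
  have h1 := Finset.card_le_card hcover
  rw [Finset.card_univ, Fintype.card_fun] at h1
  exact h1.trans (Finset.card_biUnion_le_card_mul _ _ _ fun f _ =>
    card_filter_le_card_agree_le f a)

end Code

theorem choose_mul_le (a r : ℕ) (hr : 1 ≤ r) : (a * r).choose a ≤ (3 * r) ^ a := by
  have hr0 : (0 : ℝ) < r := by exact_mod_cast hr
  -- Compare with one term of the binomial expansion of `(1 / r + 1) ^ (a * r) ≤ exp a`.
  have h1 : ((r : ℝ)⁻¹) ^ a * ((a * r).choose a : ℝ) ≤ ((r : ℝ)⁻¹ + 1) ^ (a * r) := by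
    rw [add_pow]
    have := Finset.single_le_sum (s := Finset.range (a * r + 1))
      (f := fun m => (r : ℝ)⁻¹ ^ m * 1 ^ (a * r - m) * ((a * r).choose m : ℝ))
      (fun i _ => by positivity)
      (Finset.mem_range.2 (Nat.lt_succ_of_le (Nat.le_mul_of_pos_right a hr)))
    simpa using this
  have h2 : ((r : ℝ)⁻¹ + 1) ^ (a * r) ≤ 3 ^ a := by
    rw [mul_comm, pow_mul]
    refine pow_le_pow_left₀ (by positivity) ?_ _
    calc ((r : ℝ)⁻¹ + 1) ^ r ≤ Real.exp (r : ℝ)⁻¹ ^ r :=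
          pow_le_pow_left₀ (by positivity) (Real.add_one_le_exp _) _
      _ = Real.exp 1 := by rw [← Real.exp_nat_mul, mul_inv_cancel₀ hr0.ne']
      _ ≤ 3 := Real.exp_one_lt_three.le
  have h3 := h1.trans h2
  rw [inv_pow, inv_mul_le_iff₀ (by positivity), ← mul_pow, mul_comm (r : ℝ) 3] at h3
  exact_mod_cast h3

/-- Graphs of the words of a code of length `a * (t + 1)` over an alphabet of size `6 * (t + 1)`
form a `(t + 1)`-cover-free family, since any two of them meet in fewer than `a` points. -/
theorem two_pow_le_maxTCancellative {n t a : ℕ} (ha : 1 ≤ a)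
    (hn : a * (t + 1) * (6 * (t + 1)) ≤ n) : 2 ^ a ≤ maxTCancellative n t := by
  classical
  obtain ⟨C, hC, hcard⟩ := exists_code (ι := Fin (a * (t + 1))) (κ := Fin (6 * (t + 1))) (a := a)
    (by simpa using Nat.le_mul_of_pos_right a (Nat.succ_pos t))
  simp only [Fintype.card_fin] at hcard
  have h2 : 2 ^ a ≤ C.card := by
    have hle : a ≤ a * (t + 1) := Nat.le_mul_of_pos_right a (Nat.succ_pos t)
    have h3 := choose_mul_le a (t + 1) (by omega)
    have h4 : (6 * (t + 1)) ^ a * (6 * (t + 1)) ^ (a * (t + 1) - a) ≤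
        (C.card * (3 * (t + 1)) ^ a) * (6 * (t + 1)) ^ (a * (t + 1) - a) := by
      rw [← pow_add, Nat.add_sub_cancel' hle]
      refine hcard.trans ?_
      rw [← mul_assoc]
      gcongr
    have h5 := Nat.le_of_mul_le_mul_right h4 (by positivity)
    have h6 : (6 * (t + 1)) ^ a = 2 ^ a * (3 * (t + 1)) ^ a := by rw [← mul_pow]; ring_nf
    rw [h6] at h5
    exact Nat.le_of_mul_le_mul_right h5 (by positivity)
  obtain ⟨e⟩ : Nonempty (Fin (a * (t + 1)) × Fin (6 * (t + 1)) ↪ Fin n) :=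
    Function.Embedding.nonempty_of_card_le (by simpa using hn)
  let Γ : (Fin (a * (t + 1)) → Fin (6 * (t + 1))) → Finset (Fin n) := fun f =>
    Finset.univ.image fun i => e (i, f i)
  have hΓ : Function.Injective Γ := by
    intro f g hfg
    funext i
    have : e (i, f i) ∈ Γ g := hfg ▸ Finset.mem_image_of_mem _ (Finset.mem_univ i)
    obtain ⟨j, -, hj⟩ := Finset.mem_image.1 this
    have := e.injective hj
    simp only [Prod.mk.injEq] at this
    obtain ⟨rfl, h⟩ := this
    exact h.symm
  have hcf : IsCoverFree (t + 1) (C.image Γ) := by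
    refine isCoverFree_of_card_inter_le (k := a * (t + 1)) (m := a - 1) ?_ ?_ ?_
    · intro B hB
      obtain ⟨f, -, rfl⟩ := Finset.mem_image.1 hB
      rw [Finset.card_image_of_injective _ fun i j hij => (Prod.mk.inj (e.injective hij)).1]
      simp
    · intro B hB A hA hne
      obtain ⟨f, hf, rfl⟩ := Finset.mem_image.1 hB
      obtain ⟨g, hg, rfl⟩ := Finset.mem_image.1 hA
      have hlt := hC f hf g hg fun h => hne (h ▸ rfl)
      have hsub : Γ f ∩ Γ g ⊆ (Finset.univ.filter fun i => f i = g i).image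
          fun i => e (i, f i) := by
        intro x hx
        obtain ⟨hx1, hx2⟩ := Finset.mem_inter.1 hx
        obtain ⟨i, -, rfl⟩ := Finset.mem_image.1 hx1
        obtain ⟨j, -, hj⟩ := Finset.mem_image.1 hx2
        have := e.injective hj
        simp only [Prod.mk.injEq] at this
        obtain ⟨rfl, h⟩ := this
        exact Finset.mem_image_of_mem _ (by simp [h])
      have := (Finset.card_le_card hsub).trans Finset.card_image_le
      omega
    · rw [mul_comm]
      exact Nat.mul_lt_mul_of_pos_right (by omega) (Nat.succ_pos t)
  refine h2.trans ?_
  rw [← Finset.card_image_of_injective C hΓ]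
  exact (maxTCancellative_isGreatest n t).2 ⟨_, hcf.isTCancellative, rfl⟩

/-! ### Asymptotics -/

theorem lower_bound_logb {t n : ℕ} (ht : 2 ≤ t) (hn : 24 * t ^ 2 < n) :
    1 / 54 * (1 / (t : ℝ) ^ 2) < Real.logb 2 (maxTCancellative n t : ℝ) / (n : ℝ) := by
  have hd : 0 < 6 * (t + 1) ^ 2 := by positivity
  have hd' : 2 * (6 * (t + 1) ^ 2) ≤ 27 * t ^ 2 := by nlinarith
  have hdn : 6 * (t + 1) ^ 2 ≤ n := by nlinarith
  set a := n / (6 * (t + 1) ^ 2) with ha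
  have ha1 : 1 ≤ a := (Nat.one_le_div_iff hd).2 hdn
  have ha2 : a * (6 * (t + 1) ^ 2) ≤ n := Nat.div_mul_le_self _ _
  have ha3 : n < 54 * t ^ 2 * a := by
    have h1 : n < (a + 1) * (6 * (t + 1) ^ 2) := by
      rw [mul_comm]; exact Nat.lt_mul_div_succ n hd
    nlinarith
  have h := two_pow_le_maxTCancellative (n := n) (t := t) ha1 (by linarith [ha2])
  have h' : (a : ℝ) ≤ Real.logb 2 (maxTCancellative n t : ℝ) := by
    have h2 : (2 : ℝ) ^ a ≤ maxTCancellative n t := by exact_mod_cast h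
    rw [Real.le_logb_iff_rpow_le one_lt_two (lt_of_lt_of_le (by positivity) h2)]
    rwa [Real.rpow_natCast]
  have hn0 : (0 : ℝ) < n := by exact_mod_cast (by omega : 0 < n)
  have ht0 : (0 : ℝ) < t := by exact_mod_cast (by omega : 0 < t)
  have ha3' : (n : ℝ) < 54 * t ^ 2 * a := by exact_mod_cast ha3
  rw [lt_div_iff₀ hn0, div_mul_div_comm, one_mul, div_mul_eq_mul_div, div_lt_iff₀ (by positivity)]
  nlinarith

theorem upper_bound_logb {t n : ℕ} (ht : 2 ≤ t) (hn : 24 * t ^ 2 < n) :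
    Real.logb 2 (maxTCancellative n t : ℝ) / (n : ℝ) <
      60 * (Real.logb 2 (t : ℝ) / (t : ℝ) ^ 2) := by
  have hn0 : (0 : ℝ) < n := by exact_mod_cast (by omega : 0 < n)
  have htR : (2 : ℝ) ≤ t := by exact_mod_cast ht
  have ht0 : (0 : ℝ) < t := by linarith
  have hnR : 24 * (t : ℝ) ^ 2 < n := by exact_mod_cast hn
  have hlog : 1 ≤ Real.logb 2 t := by
    rw [Real.le_logb_iff_rpow_le one_lt_two ht0, Real.rpow_one]
    exact htR
  obtain ⟨⟨F, hF, hFc⟩, -⟩ := maxTCancellative_isGreatest n t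
  set s := t / 2 with hs
  have hs1 : 1 ≤ s := by omega
  have hst : t ≤ 3 * s := by omega
  have hst' : 2 * s ≤ t := by omega
  -- The least `τ` with `2 * n < τ * s ^ 2`. With `D = s ^ 2` both `τ * log D` and `n / D` are
  -- `O(n * log t / t ^ 2)`.
  set τ := 2 * n / s ^ 2 + 1 with hτ
  set X : ℝ := ((s ^ 2 : ℕ) : ℝ) ^ τ * Real.exp (n / (s ^ 2 : ℕ)) with hX
  have hs1R : (1 : ℝ) ≤ s := by exact_mod_cast hs1
  have hstR : (t : ℝ) ≤ 3 * s := by exact_mod_cast hst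
  have hstR' : 2 * (s : ℝ) ≤ t := by exact_mod_cast hst'
  have hX1 : 1 ≤ X := by
    refine one_le_mul_of_one_le_of_one_le (one_le_pow₀ ?_) (Real.one_le_exp (by positivity))
    exact_mod_cast Nat.one_le_pow _ _ hs1
  have hcard : (maxTCancellative n t : ℝ) ≤ (t : ℝ) ^ 2 * X := by
    rw [← hFc]
    by_cases hlt : t + 2 ≤ F.card
    · obtain ⟨G, -, hG, hGc⟩ := hF.exists_isCoverFree hst' hlt
      have hGb := hG.card_le (τ := τ) (D := s ^ 2) (Nat.one_le_pow _ _ hs1) (by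
        rw [Fintype.card_fin]
        have h1 : 2 * n < s ^ 2 * τ := Nat.lt_mul_div_succ (2 * n) (by positivity)
        nlinarith [Nat.zero_le (τ * s)])
      rw [Fintype.card_fin, ← hX] at hGb
      have hGc' : (F.card : ℝ) ≤ G.card + (s + 1) := by exact_mod_cast hGc
      have ht2 : (t : ℝ) + 2 ≤ (t : ℝ) ^ 2 := by nlinarith
      have h1 : ((t : ℝ) + 2) * X ≤ (t : ℝ) ^ 2 * X := by gcongr
      nlinarith
    · have : (F.card : ℝ) ≤ t + 1 := by exact_mod_cast (by omega)
      nlinarith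
  have hlogX : Real.logb 2 X ≤
      (18 * n / (t : ℝ) ^ 2 + 1) * (2 * Real.logb 2 t) + 18 * n / (t : ℝ) ^ 2 := by
    have hsq : (n : ℝ) / (s ^ 2 : ℕ) ≤ 9 * n / (t : ℝ) ^ 2 := by
      rw [div_le_div_iff₀ (by positivity) (by positivity)]
      push_cast
      nlinarith [mul_le_mul_of_nonneg_left (pow_le_pow_left₀ ht0.le hstR 2) hn0.le]
    rw [hX, Real.logb_mul (by positivity) (by positivity), Real.logb_pow]
    refine add_le_add (mul_le_mul ?_ ?_ ?_ (by positivity)) ?_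
    · have h1 : ((2 * n / s ^ 2 : ℕ) : ℝ) ≤ ((2 * n : ℕ) : ℝ) / ((s ^ 2 : ℕ) : ℝ) :=
        Nat.cast_div_le
      rw [hτ]
      push_cast at h1 hsq ⊢
      rw [mul_div_assoc] at h1 hsq ⊢
      linarith
    · push_cast
      rw [Real.logb_pow]
      push_cast
      have := Real.logb_le_logb_of_le one_lt_two (by linarith) (by linarith : (s : ℝ) ≤ t)
      linarith
    · exact Real.logb_nonneg one_lt_two (by exact_mod_cast Nat.one_le_pow _ _ hs1)
    · rw [Real.logb, Real.log_exp, div_le_iff₀ (Real.log_pos one_lt_two)]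
      have := Real.log_two_gt_d9
      have h0 : 0 ≤ 9 * (n : ℝ) / (t : ℝ) ^ 2 := by positivity
      have h1 : 18 * (n : ℝ) / (t : ℝ) ^ 2 = 2 * (9 * (n : ℝ) / (t : ℝ) ^ 2) := by ring
      rw [h1]
      nlinarith
  have hmain : Real.logb 2 (maxTCancellative n t : ℝ) ≤ 2 * Real.logb 2 t + Real.logb 2 X := by
    have hpos : (0 : ℝ) < maxTCancellative n t := by
      have := two_pow_le_maxTCancellative (n := n) (t := t) le_rfl (by nlinarith)
      exact_mod_cast (by omega)
    refine (Real.logb_le_logb_of_le one_lt_two hpos hcard).trans (le_of_eq ?_)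
    rw [Real.logb_mul (by positivity) (by positivity), Real.logb_pow]
    norm_num
  rw [div_lt_iff₀ hn0]
  set y : ℝ := n / (t : ℝ) ^ 2 with hy
  have hy24 : 24 < y := by rw [hy, lt_div_iff₀ (by positivity)]; exact hnR
  have e1 : 18 * (n : ℝ) / (t : ℝ) ^ 2 = 18 * y := by rw [hy]; ring
  have e2 : 60 * (Real.logb 2 (t : ℝ) / (t : ℝ) ^ 2) * n = 60 * y * Real.logb 2 t := by
    rw [hy]; ring
  rw [e2]
  rw [e1] at hlogX
  nlinarith

theorem mainTheorem6 :
    ∃ β₁ β₂ : ℝ, 0 < β₁ ∧ 0 < β₂ ∧ ∃ n₀ : ℕ → ℕ, ∀ t n : ℕ, 2 ≤ t → n₀ t < n →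
      β₁ * (1 / (t : ℝ) ^ 2) < Real.logb 2 (maxTCancellative n t : ℝ) / (n : ℝ) ∧
      Real.logb 2 (maxTCancellative n t : ℝ) / (n : ℝ) <
        β₂ * (Real.logb 2 (t : ℝ) / (t : ℝ) ^ 2) :=
  ⟨1 / 54, 60, by norm_num, by norm_num, fun t => 24 * t ^ 2, fun _ _ ht hn =>
    ⟨lower_bound_logb ht hn, upper_bound_logb ht hn⟩⟩
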